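/- Let $k$ be a field and let $\mathcal B$ be a $k$-linear abelian category such that, for all objects $X,Y$, the spaces $\operatorname{Ext}^i_{\mathcal B}(X,Y)$, $i\ge 0$ (in particular $\operatorname{Hom}(X,Y)=\operatorname{Ext}^0(X,Y)$), are finite dimensional over $k$ and only finitely many of them are non-zero. An object $T$ of $\mathcal B$ is called exceptional if $\operatorname{Ext}^i_{\mathcal B}(T,T)=0$ for $i>0$ and $\operatorname{End}_{\mathcal B}(T)$ is a division algebra; a sequence $T_1,\dots,T_n$ of exceptional objects is an exceptional collection if $\operatorname{Ext}^m_{\mathcal B}(T_i,T_j)=0$ for all $m$ and all $j>i$. An object $T$ has projective dimension $\le 1$ if $\operatorname{Ext}^s_{\mathcal B}(T,-)=0$ for all $s>1$. Let $T_1,\dots,T_n$ be an exceptional collection in $\mathcal B$ consisting of objects of projective dimension $\le 1$, put $T=\bigoplus_{i=1}^n T_i$, and let $T^\perp$ be the full subcategory of $\mathcal B$ whose objects are the $X$ with $\operatorname{Ext}^i_{\mathcal B}(T,X)=0$ for all $i\ge 0$ (this is an abelian category, since $T$ has projective dimension $\le 1$). Then there is an isomorphism of abelian groups $$K_0(\mathcal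 B)\;\cong\;\mathbb Z^n\oplus K_0(T^\perp),$$ where $K_0$ of an abelian category is the abelian group generated by the symbols $[X]$, $X$ an object, subject to the relations $[X_2]=[X_1]+[X_3]$ for every short exact sequence $0\to X_1\to X_2\to X_3\to 0$ in that category. -/

import Mathlib

open CategoryTheory CategoryTheory.Limits CategoryTheory.Abelian
open scoped ZeroObject

attribute [local instance] Abelian.hasFiniteBiproducts

universe w v u t

namespace ExceptionalCollection

noncomputable section

section GrothendieckGroup

variable (A : Type u) [Category.{v} A] [Abelian A]

/-- The subgroup of the free abelian group on the objects of `A` that is generated by the elements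
`[X₂] - [X₁] - [X₃]`, one for each short exact sequence `0 ⟶ X₁ ⟶ X₂ ⟶ X₃ ⟶ 0` in `A`. -/
def shortExactRelations : AddSubgroup (FreeAbelianGroup A) :=
  AddSubgroup.closure
    {x | ∃ S : ShortComplex A, S.ShortExact ∧
      x = FreeAbelianGroup.of S.X₂ - FreeAbelianGroup.of S.X₁ - FreeAbelianGroup.of S.X₃}

/-- The Grothendieck group `K₀(A)` of an abelian category `A`. -/
abbrev K0 : Type u := FreeAbelianGroup A ⧸ shortExactRelations A

end GrothendieckGroup

variable {C : Type u} [Category.{v} C] [Abelian C] [HasExt.{w} C]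

/-- The standing finiteness condition on a `k`-linear abelian category: all `Extⁱ(X, Y)`
(in particular all `Hom(X, Y) = Ext⁰(X, Y)`) are finite dimensional over `k`, and for fixed `X, Y`
only finitely many of them are non-zero. -/
structure IsExtFinite (k : Type t) [Field k] (C : Type u) [Category.{v} C] [Abelian C]
    [Linear k C] [HasExt.{w} C] : Prop where
  finite_ext (X Y : C) (i : ℕ) : Module.Finite k (Ext.{w} X Y i)
  finite_degrees (X Y : C) : {i : ℕ | Nontrivial (Ext.{w} X Y i)}.Finite

/-- An object `T` is exceptional if `Extⁱ(T, T) = 0` for `i > 0` and `End(T)` is a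
division ring. -/
structure IsExceptional (T : C) : Prop where
  ext_eq_zero (i : ℕ) (hi : 0 < i) : Subsingleton (Ext.{w} T T i)
  nontrivial_end : Nontrivial (End T)
  isUnit_of_ne_zero (f : End T) (hf : f ≠ 0) : IsUnit f

/-- A sequence of exceptional objects is an exceptional collection if `Ext^*(Tᵢ, Tⱼ) = 0`
for `j > i`. -/
structure IsExceptionalCollection {n : ℕ} (T : Fin n → C) : Prop where
  isExceptional (i : Fin n) : IsExceptional.{w} (T i)
  ext_eq_zero (i j : Fin n) (hij : i < j) (m : ℕ) : Subsingleton (Ext.{w} (T i) (T j) m)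

/-- The right perpendicular `T^⊥`: the objects `X` with `Extⁱ(T, X) = 0` for all `i`. -/
def rightPerp (T : C) : ObjectProperty C :=
  fun X => ∀ i : ℕ, Subsingleton (Ext.{w} T X i)

/-! If `T` has projective dimension at most one, then the full subcategory `T^⊥` is an abelian
category (with kernels, cokernels and finite products computed in the ambient category). -/

section Abelian

lemma ext_subsingleton_iff {X Y : C} {i : ℕ} :
    Subsingleton (Ext.{w} X Y i) ↔ ∀ e : Ext.{w} X Y i, e = 0 :=
  ⟨fun _ e => Subsingleton.elim e 0, fun h => ⟨fun a b => (h a).trans (h b).symm⟩⟩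

lemma rightPerp_of_iso (T : C) {X Y : C} (e : X ≅ Y) (hX : rightPerp.{w} T X) :
    rightPerp.{w} T Y := by
  intro i
  have := hX i
  rw [ext_subsingleton_iff]
  intro x
  have h : x.comp (Ext.mk₀ e.inv) (add_zero i) = 0 := Subsingleton.elim _ _
  calc x = (x.comp (Ext.mk₀ e.inv) (add_zero i)).comp (Ext.mk₀ e.hom) (add_zero i) := by simp
    _ = 0 := by rw [h, Ext.zero_comp]

instance (T : C) : (rightPerp.{w} T).IsClosedUnderIsomorphisms where
  of_iso e hX := rightPerp_of_iso T e hX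

instance (T : C) : (rightPerp.{w} T).ContainsZero where
  exists_zero := ⟨0, isZero_zero C, fun i => by
    rw [ext_subsingleton_iff]
    intro x
    have h : Ext.mk₀ (𝟙 (0 : C)) = 0 := by
      rw [(isZero_zero C).eq_of_src (𝟙 (0 : C)) 0, Ext.mk₀_zero]
    calc x = x.comp (Ext.mk₀ (𝟙 (0 : C))) (add_zero i) := (Ext.comp_mk₀_id x).symm
      _ = 0 := by rw [h, Ext.comp_zero]⟩

instance (T : C) : (rightPerp.{w} T).IsClosedUnderFiniteProducts where
  isClosedUnderLimitsOfShape J _ := ⟨by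
    have := Fintype.ofFinite J
    rintro X ⟨p⟩
    have e : (⨁ fun j => p.diag.obj ⟨j⟩) ≅ X :=
      biproduct.isoProduct _ ≪≫ HasLimit.isoOfNatIso Discrete.natIsoFunctor.symm ≪≫
        (limit.isLimit p.diag).conePointUniqueUpToIso p.isLimit
    refine rightPerp_of_iso T e fun i => ?_
    have h (j : J) : Subsingleton (Ext.{w} T (p.diag.obj ⟨j⟩) i) := p.prop_diag_obj ⟨j⟩ i
    exact (Ext.addEquivBiproduct T (biproduct.isBilimit fun j => p.diag.obj ⟨j⟩) i).subsingleton⟩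

lemma rightPerp_kernel_cokernel (T : C) [HasProjectiveDimensionLE T 1] {X Y : C} (f : X ⟶ Y)
    (hX : rightPerp.{w} T X) (hY : rightPerp.{w} T Y) :
    rightPerp.{w} T (kernel f) ∧ rightPerp.{w} T (cokernel f) := by
  have hS₁ : (ShortComplex.mk (kernel.ι f) (cokernel.π (kernel.ι f))
      (cokernel.condition _)).ShortExact :=
    { exact := ShortComplex.exact_of_g_is_cokernel _ (cokernelIsCokernel _) }
  have hS₂ : (ShortComplex.mk (kernel.ι (cokernel.π f)) (cokernel.π f)
      (kernel.condition _)).ShortExact :=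
    { exact := ShortComplex.exact_of_f_is_kernel _ (kernelIsKernel _) }
  have mono_zero {M N : C} (g : M ⟶ N) [Mono g] (hN : rightPerp.{w} T N) :
      Subsingleton (Ext.{w} T M 0) := by
    have := hN 0
    exact (Ext.postcomp_mk₀_injective_of_mono T g).subsingleton
  have hI : rightPerp.{w} T (Abelian.image f) := by
    intro i
    obtain _ | i := i
    · exact mono_zero (Abelian.image.ι f) hY
    · have hc : Subsingleton (Ext.{w} T (Abelian.coimage f) (i + 1)) := by
        rw [ext_subsingleton_iff]
        intro x
        have := hX (i + 1)
        obtain ⟨y, hy⟩ := Ext.covariant_sequence_exact₃ T hS₁ x rfl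
          (Ext.eq_zero_of_hasProjectiveDimensionLT _ 2 (by omega))
        rw [← hy, Subsingleton.elim y 0, Ext.zero_comp]
      rw [ext_subsingleton_iff] at hc ⊢
      intro x
      have h := hc (x.comp (Ext.mk₀ (Abelian.coimageIsoImage f).inv) (add_zero _))
      calc x = (x.comp (Ext.mk₀ (Abelian.coimageIsoImage f).inv) (add_zero _)).comp
            (Ext.mk₀ (Abelian.coimageIsoImage f).hom) (add_zero _) := by simp
        _ = 0 := by rw [h, Ext.zero_comp]
  have hc : rightPerp.{w} T (Abelian.coimage f) :=
    rightPerp_of_iso T (Abelian.coimageIsoImage f).symm hI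
  refine ⟨fun i => ?_, fun i => ?_⟩
  · obtain _ | i := i
    · exact mono_zero (kernel.ι f) hX
    · rw [ext_subsingleton_iff]
      intro x
      have := hX (i + 1)
      have := hc i
      obtain ⟨y, hy⟩ := Ext.covariant_sequence_exact₁ T hS₁ x (Subsingleton.elim _ _) rfl
      rw [← hy, show y = 0 from Subsingleton.elim (α := Ext T (Abelian.coimage f) i) y 0,
        Ext.zero_comp]
  · rw [ext_subsingleton_iff]
    intro x
    have := hY i
    have := hI (i + 1)
    obtain ⟨y, hy⟩ := Ext.covariant_sequence_exact₃ T hS₂ x rfl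
      (Subsingleton.elim (α := Ext T (Abelian.image f) (i + 1)) _ _)
    rw [← hy, Subsingleton.elim y 0, Ext.zero_comp]

instance (T : C) [HasProjectiveDimensionLE T 1] : (rightPerp.{w} T).IsClosedUnderKernels where
  kernels_le := by
    rintro _ ⟨f, k, hk, hf⟩
    exact rightPerp_of_iso T ((kernelIsKernel f).conePointUniqueUpToIso hk)
      (rightPerp_kernel_cokernel T f hf.1 hf.2).1

instance (T : C) [HasProjectiveDimensionLE T 1] : (rightPerp.{w} T).IsClosedUnderCokernels where
  cokernels_le := by
    rintro _ ⟨f, k, hk, hf⟩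
    exact rightPerp_of_iso T ((cokernelIsCokernel f).coconePointUniqueUpToIso hk)
      (rightPerp_kernel_cokernel T f hf.1 hf.2).2

instance rightPerpAbelian (T : C) [HasProjectiveDimensionLE T 1] :
    Abelian (rightPerp.{w} T).FullSubcategory :=
  inferInstance

/-- A finite direct sum of objects of projective dimension at most one is again such. -/
instance biproduct_projectiveDimension {C : Type u} [Category.{v} C] [Abelian C] {n : ℕ}
    (T : Fin n → C) [∀ i, HasProjectiveDimensionLE (T i) 1] :
    HasProjectiveDimensionLE (⨁ T) 1 where
  subsingleton' i hi Y := by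
    let := HasExt.standard C
    have h (j : Fin n) : Subsingleton (Ext.{max u v} (T j) Y i) :=
      HasProjectiveDimensionLT.subsingleton (T j) 2 i hi Y
    exact (Ext.biproductAddEquiv (biproduct.isBilimit T) Y i).subsingleton

end Abelian

end

end ExceptionalCollection

open ExceptionalCollection

/-!
Let `P` be a full subcategory closed under kernels, cokernels and extensions and containing an
exceptional object `T` of projective dimension at most one. Every `X` in `P` embeds in its universal
extension by copies of `T`, which lies in the class of objects with `Ext¹(T, -) = 0`; as this class
is closed under quotients, it has the same Grothendieck group as `P`. An object `X` of this class
receives a map `f : F ⟶ X` from a direct sum of copies of `T` which is bijective on `Hom(T, -)`,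
because `End T` is a division ring, and the kernel and cokernel of `f` are perpendicular to `T`. The
snake lemma shows that `X ↦ (rank F, [coker f] - [ker f])` is additive, so that
`K₀(P) ≃ ℤ × K₀(P ∩ T^⊥)`. Now replace `P` by `P ∩ T^⊥` and continue with the next object of the
collection, which lies in it.
-/

namespace ExceptionalCollection

/-! ### Extensions realizing classes in `Ext¹` -/

section Realization

open Pretriangulated DerivedCategory

variable {C : Type u} [Category.{v} C] [Abelian C]

lemma shortExact_of_distinguished [HasDerivedCategory.{w} C] {X E Z : C} (f : X ⟶ E) (g : E ⟶ Z)
    (h : (singleFunctor C 0).obj Z ⟶ ((singleFunctor C 0).obj X)⟦(1 : ℤ)⟧)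
    (hT : Triangle.mk ((singleFunctor C 0).map f) ((singleFunctor C 0).map g) h ∈
      distTriang (DerivedCategory C)) :
    ∃ w : f ≫ g = 0, (ShortComplex.mk f g w).ShortExact := by
  have w : f ≫ g = 0 := (singleFunctor C 0).map_injective (by
    rw [Functor.map_comp, Functor.map_zero]
    exact comp_distTriang_mor_zero₁₂ _ hT)
  let H := singleFunctor C 0 ⋙ homologyFunctor C 0
  have hS : ((ShortComplex.mk f g w).map H).ShortExact :=
    { exact := HomologySequence.exact₂ _ hT 0
      mono_f := (HomologySequence.mono_homologyMap_mor₁_iff _ hT (-1) 0).2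
        ((isZero_of_isGE ((singleFunctor C 0).obj Z) 0 (-1) (by lia)).eq_of_src _ _)
      epi_g := (HomologySequence.epi_homologyMap_mor₂_iff _ hT 0 1).2
        ((isZero_of_isLE ((singleFunctor C 0).obj X) 0 1 (by lia)).eq_of_tgt _ _) }
  exact ⟨w, ShortComplex.shortExact_of_iso
    ((ShortComplex.mk f g w).mapNatIso (singleFunctorCompHomologyFunctorIso C 0)) hS⟩

lemma exists_distinguished_singleFunctor [HasDerivedCategory.{w} C] {X Z : C}
    (h : (singleFunctor C 0).obj Z ⟶ ((singleFunctor C 0).obj X)⟦(1 : ℤ)⟧) :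
    ∃ (E : C) (f : X ⟶ E) (g : E ⟶ Z),
      Triangle.mk ((singleFunctor C 0).map f) ((singleFunctor C 0).map g) h ∈
        distTriang (DerivedCategory C) := by
  obtain ⟨E', f', g', hT⟩ := distinguished_cocone_triangle₂ h
  have : E'.IsGE 0 := TStructure.t.isGE₂ _ hT 0
    (inferInstanceAs (((singleFunctor C 0).obj X).IsGE 0))
    (inferInstanceAs (((singleFunctor C 0).obj Z).IsGE 0))
  have : E'.IsLE 0 := TStructure.t.isLE₂ _ hT 0
    (inferInstanceAs (((singleFunctor C 0).obj X).IsLE 0))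
    (inferInstanceAs (((singleFunctor C 0).obj Z).IsLE 0))
  obtain ⟨E, ⟨i⟩⟩ := exists_iso_singleFunctor_obj_of_isGE_of_isLE E' 0
  obtain ⟨f, hf⟩ := (singleFunctor C 0).map_surjective (f' ≫ i.hom)
  obtain ⟨g, hg⟩ := (singleFunctor C 0).map_surjective (i.inv ≫ g')
  have comm₁ : (singleFunctor C 0).map f ≫ i.inv = 𝟙 _ ≫ f' := by simp [hf]
  have comm₂ : (singleFunctor C 0).map g ≫ 𝟙 _ = i.inv ≫ g' := by simp [hg]
  have comm₃ : h ≫ (shiftFunctor (DerivedCategory C) (1 : ℤ)).map (𝟙 _) = 𝟙 _ ≫ h := by simp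
  exact ⟨E, f, g, isomorphic_distinguished _ hT _
    (Triangle.isoMk _ _ (Iso.refl _) i.symm (Iso.refl _) comm₁ comm₂ comm₃)⟩

lemma exists_shortExact_comp_mk₀_eq_zero [HasExt.{w} C] {X Z : C} (e : Ext.{w} Z X 1) :
    ∃ (E : C) (f : X ⟶ E) (g : E ⟶ Z) (w : f ≫ g = 0), (ShortComplex.mk f g w).ShortExact ∧
      e.comp (Ext.mk₀ f) (add_zero 1) = 0 := by
  let := HasDerivedCategory.standard C
  obtain ⟨E, f, g, hT⟩ := exists_distinguished_singleFunctor e.hom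
  obtain ⟨w, hS⟩ := shortExact_of_distinguished f g _ hT
  refine ⟨E, f, g, w, hS, ?_⟩
  ext
  simp only [Ext.comp_hom, Ext.mk₀_hom, Ext.zero_hom, ShiftedHom.comp_mk₀]
  exact comp_distTriang_mor_zero₃₁ _ hT

end Realization

noncomputable section

variable {C : Type u} [Category.{v} C] [Abelian C]

lemma shortExact_iso_zero {X Y Z : C} (e : X ≅ Y) (hZ : IsZero Z) :
    (ShortComplex.mk e.hom (0 : Y ⟶ Z) comp_zero).ShortExact :=
  (ShortComplex.Splitting.ofIsIsoOfIsZero _ (inferInstanceAs (IsIso e.hom)) hZ).shortExact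

section Wide

/-- A full subcategory of an abelian category is wide if it contains a zero object and is closed
under kernels, cokernels and extensions: it is then an exact abelian subcategory, and so has its
own notion of perpendicular subcategories. -/
class IsWide (P : ObjectProperty C) : Prop extends P.ContainsZero, P.IsClosedUnderKernels,
  P.IsClosedUnderCokernels, P.IsClosedUnderExtensions

variable (P : ObjectProperty C)

instance (priority := 100) isClosedUnderIsomorphisms_of_extensions [P.ContainsZero]
    [P.IsClosedUnderExtensions] : P.IsClosedUnderIsomorphisms where
  of_iso {X Y} e hX := by
    obtain ⟨Z, hZ, hPZ⟩ := P.exists_prop_of_containsZero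
    exact P.prop_X₂_of_shortExact (shortExact_iso_zero e hZ) hX hPZ

instance isWide_top : IsWide (⊤ : ObjectProperty C) where
  kernels_le := le_top
  cokernels_le := le_top

lemma prop_image [P.IsClosedUnderKernels] [P.IsClosedUnderCokernels] {X Y : C} (f : X ⟶ Y)
    (hX : P X) (hY : P Y) : P (Abelian.image f) :=
  P.prop_kernel _ hY (P.prop_cokernel f hX hY)

end Wide

section ShortExact

lemma shortExact_kernel_image {X Y : C} (f : X ⟶ Y) :
    (ShortComplex.mk (kernel.ι f) (Abelian.factorThruImage f) (by
      rw [← cancel_mono (Abelian.image.ι f)]; simp)).ShortExact where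
  exact := by
    rw [ShortComplex.exact_iff_exact_up_to_refinements]
    intro A x hx
    have hx' : x ≫ f = 0 := by simpa using hx =≫ Abelian.image.ι f
    exact ⟨A, 𝟙 A, inferInstance, kernel.lift f x hx', by simp⟩

lemma shortExact_image_cokernel {X Y : C} (f : X ⟶ Y) :
    (ShortComplex.mk (Abelian.image.ι f) (cokernel.π f) (kernel.condition _)).ShortExact where
  exact := ShortComplex.exact_of_f_is_kernel _ (kernelIsKernel _)

lemma shortExact_cokernel {X Y : C} (f : X ⟶ Y) [Mono f] :
    (ShortComplex.mk f (cokernel.π f) (cokernel.condition f)).ShortExact where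
  exact := ShortComplex.exact_cokernel f

lemma mono_kernel_map {X Y X' Y' : C} (f : X ⟶ Y) (f' : X' ⟶ Y') (p : X ⟶ X') (q : Y ⟶ Y')
    [Mono p] (w : f ≫ q = p ≫ f') : Mono (kernel.map f f' p q w) := by
  have : Mono (kernel.map f f' p q w ≫ kernel.ι f') := by
    rw [kernel.lift_ι]
    infer_instance
  exact mono_of_mono _ (kernel.ι f')

lemma epi_cokernel_map {X Y X' Y' : C} (f : X ⟶ Y) (f' : X' ⟶ Y') (p : X ⟶ X') (q : Y ⟶ Y')
    [Epi q] (w : f ≫ q = p ≫ f') : Epi (cokernel.map f f' p q w) := by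
  have : Epi (cokernel.π f ≫ cokernel.map f f' p q w) := by
    rw [cokernel.π_desc]
    infer_instance
  exact epi_of_epi (cokernel.π f) _

/-- The input of the snake lemma given by a morphism of short exact sequences, with the chosen
kernels and cokernels of its components as outer rows. -/
def snakeInput {S₁ S₂ : ShortComplex C} (α : S₁ ⟶ S₂) (hS₁ : S₁.ShortExact)
    (hS₂ : S₂.ShortExact) : ShortComplex.SnakeInput C where
  L₀ := ShortComplex.mk (kernel.map α.τ₁ α.τ₂ S₁.f S₂.f α.comm₁₂)
    (kernel.map α.τ₂ α.τ₃ S₁.g S₂.g α.comm₂₃) (by ext; simp)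
  L₁ := S₁
  L₂ := S₂
  L₃ := ShortComplex.mk (cokernel.map α.τ₁ α.τ₂ S₁.f S₂.f α.comm₁₂)
    (cokernel.map α.τ₂ α.τ₃ S₁.g S₂.g α.comm₂₃) (by ext; simp)
  v₀₁ := { τ₁ := kernel.ι _, τ₂ := kernel.ι _, τ₃ := kernel.ι _ }
  v₁₂ := α
  v₂₃ := { τ₁ := cokernel.π _, τ₂ := cokernel.π _, τ₃ := cokernel.π _ }
  h₀ := by
    apply ShortComplex.isLimitOfIsLimitπ <;> apply (KernelFork.isLimitMapConeEquiv _ _).2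
    all_goals exact kernelIsKernel _
  h₃ := by
    apply ShortComplex.isColimitOfIsColimitπ <;>
      apply (CokernelCofork.isColimitMapCoconeEquiv _ _).2
    all_goals exact cokernelIsCokernel _
  L₁_exact := hS₁.exact
  epi_L₁_g := hS₁.epi_g
  L₂_exact := hS₂.exact
  mono_L₂_f := hS₂.mono_f

end ShortExact

/-! ### Additive functions and the snake lemma -/

section Additive

/-- A function on the objects of an abelian category with values in an abelian group is additive
on `P` if it is additive on the short exact sequences with all three terms in `P`. -/
def IsAdditiveOn {G : Type*} [AddCommGroup G] (P : ObjectProperty C) (φ : C → G) : Prop :=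
  ∀ S : ShortComplex C, S.ShortExact → P S.X₁ → P S.X₂ → P S.X₃ → φ S.X₂ = φ S.X₁ + φ S.X₃

variable {G : Type*} [AddCommGroup G]

/-- The value of an additive function `φ` at the cone of `f`, the two-term complex with homology
the cokernel and the kernel of `f` in even and odd degree respectively. -/
def coneClass (φ : C → G) {X Y : C} (f : X ⟶ Y) : G :=
  φ (cokernel f) - φ (kernel f)

namespace IsAdditiveOn

variable {P : ObjectProperty C} {φ : C → G}

lemma mono {P' : ObjectProperty C} (hφ : IsAdditiveOn P φ) (h : P' ≤ P) : IsAdditiveOn P' φ :=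
  fun S hS h₁ h₂ h₃ => hφ S hS (h _ h₁) (h _ h₂) (h _ h₃)

lemma map_isZero (hφ : IsAdditiveOn P φ) {X : C} (hX : IsZero X) (hPX : P X) : φ X = 0 := by
  simpa using hφ _ (shortExact_iso_zero (Iso.refl X) hX) hPX hPX hPX

lemma map_iso [P.ContainsZero] (hφ : IsAdditiveOn P φ) {X Y : C} (e : X ≅ Y) (hX : P X)
    (hY : P Y) : φ X = φ Y := by
  obtain ⟨Z, hZ, hPZ⟩ := P.exists_prop_of_containsZero
  simpa [hφ.map_isZero hZ hPZ] using (hφ _ (shortExact_iso_zero e hZ) hX hY hPZ).symm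

lemma map_biprod [P.IsClosedUnderExtensions] (hφ : IsAdditiveOn P φ) {X Y : C}
    (hX : P X) (hY : P Y) : φ (X ⊞ Y) = φ X + φ Y :=
  hφ _ (ShortComplex.Splitting.ofHasBinaryBiproduct X Y).shortExact hX (P.prop_biprod hX hY) hY

lemma coneClass_eq_sub (hφ : IsAdditiveOn P φ) {X Y : C} (f : X ⟶ Y) (hX : P X) (hY : P Y)
    (hk : P (kernel f)) (hI : P (Abelian.image f)) (hc : P (cokernel f)) :
    coneClass φ f = φ Y - φ X := by
  have e : φ X = φ (kernel f) + φ (Abelian.image f) := hφ _ (shortExact_kernel_image f) hk hX hI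
  have e' : φ Y = φ (Abelian.image f) + φ (cokernel f) :=
    hφ _ (shortExact_image_cokernel f) hI hY hc
  rw [coneClass, e, e']
  abel

section KernelsAndCokernels

variable [P.IsClosedUnderKernels] [P.IsClosedUnderCokernels] (hφ : IsAdditiveOn P φ)

include hφ

lemma map_eq_kernel_add_image {X Y : C} (f : X ⟶ Y) (hX : P X) (hY : P Y) :
    φ X = φ (kernel f) + φ (Abelian.image f) :=
  hφ _ (shortExact_kernel_image f) (P.prop_kernel f hX hY) hX (prop_image P f hX hY)

lemma map_eq_image_add_cokernel {X Y : C} (f : X ⟶ Y) (hX : P X) (hY : P Y) :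
    φ Y = φ (Abelian.image f) + φ (cokernel f) :=
  hφ _ (shortExact_image_cokernel f) (prop_image P f hX hY) hY (P.prop_cokernel f hX hY)

lemma map_image_of_mono {X Y : C} (f : X ⟶ Y) [Mono f] (hX : P X) (hY : P Y) :
    φ (Abelian.image f) = φ X := by
  rw [hφ.map_eq_kernel_add_image f hX hY,
    hφ.map_isZero (isZero_kernel_of_mono f) (P.prop_kernel f hX hY), zero_add]

lemma map_image_of_epi {X Y : C} (f : X ⟶ Y) [Epi f] (hX : P X) (hY : P Y) :
    φ (Abelian.image f) = φ Y := by
  rw [hφ.map_eq_image_add_cokernel f hX hY,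
    hφ.map_isZero (isZero_cokernel_of_epi f) (P.prop_cokernel f hX hY), add_zero]

variable [P.ContainsZero]

lemma map_exact {S : ShortComplex C} (hS : S.Exact) (h₁ : P S.X₁) (h₂ : P S.X₂) (h₃ : P S.X₃) :
    φ S.X₂ = φ (Abelian.image S.f) + φ (Abelian.image S.g) := by
  have e : Abelian.image S.f ≅ kernel S.g :=
    IsLimit.conePointUniqueUpToIso hS.isLimitImage (limit.isLimit _)
  rw [hφ.map_iso e (prop_image P _ h₁ h₂) (P.prop_kernel _ h₂ h₃),
    hφ.map_eq_kernel_add_image S.g h₂ h₃]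

lemma snake (S : ShortComplex.SnakeInput C) [Mono S.L₀.f] [Epi S.L₃.g]
    (h₁ : P S.L₀.X₁) (h₂ : P S.L₀.X₂) (h₃ : P S.L₀.X₃)
    (h₁' : P S.L₃.X₁) (h₂' : P S.L₃.X₂) (h₃' : P S.L₃.X₃) :
    φ S.L₃.X₂ - φ S.L₀.X₂ = (φ S.L₃.X₁ - φ S.L₀.X₁) + (φ S.L₃.X₃ - φ S.L₀.X₃) := by
  have e₁ := hφ.map_exact S.L₀_exact h₁ h₂ h₃
  have e₂ : φ S.L₀.X₃ = φ (Abelian.image S.L₀.g) + φ (Abelian.image S.δ) :=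
    hφ.map_exact S.L₁'_exact h₂ h₃ h₁'
  have e₃ : φ S.L₃.X₁ = φ (Abelian.image S.δ) + φ (Abelian.image S.L₃.f) :=
    hφ.map_exact S.L₂'_exact h₃ h₁' h₂'
  have e₄ := hφ.map_exact S.L₃_exact h₁' h₂' h₃'
  rw [hφ.map_image_of_mono _ h₁ h₂] at e₁
  rw [hφ.map_image_of_epi _ h₂' h₃'] at e₄
  rw [e₁, e₂, e₃, e₄]
  abel

lemma coneClass_τ₂ {S₁ S₂ : ShortComplex C} (α : S₁ ⟶ S₂) (hS₁ : S₁.ShortExact)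
    (hS₂ : S₂.ShortExact) (h₁ : P (kernel α.τ₁)) (h₂ : P (kernel α.τ₂)) (h₃ : P (kernel α.τ₃))
    (h₁' : P (cokernel α.τ₁)) (h₂' : P (cokernel α.τ₂)) (h₃' : P (cokernel α.τ₃)) :
    coneClass φ α.τ₂ = coneClass φ α.τ₁ + coneClass φ α.τ₃ := by
  have := hS₁.mono_f
  have := hS₂.epi_g
  have : Mono (snakeInput α hS₁ hS₂).L₀.f := mono_kernel_map _ _ _ _ α.comm₁₂
  have : Epi (snakeInput α hS₁ hS₂).L₃.g := epi_cokernel_map _ _ _ _ α.comm₂₃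
  exact hφ.snake (snakeInput α hS₁ hS₂) h₁ h₂ h₃ h₁' h₂' h₃'

end KernelsAndCokernels

section Cone

variable [P.ContainsZero] [P.IsClosedUnderIsomorphisms] (hφ : IsAdditiveOn P φ)

include hφ

lemma coneClass_of_isIso {X Y : C} (f : X ⟶ Y) [IsIso f] : coneClass φ f = 0 := by
  have hk := isZero_kernel_of_mono f
  have hc := isZero_cokernel_of_epi f
  rw [coneClass, hφ.map_isZero hk (P.prop_of_isZero hk),
    hφ.map_isZero hc (P.prop_of_isZero hc), sub_zero]

lemma coneClass_of_isZero_src {X Y : C} (f : X ⟶ Y) (hX : IsZero X) (hY : P Y) :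
    coneClass φ f = φ Y := by
  obtain rfl : f = 0 := hX.eq_of_src _ _
  have hk : IsZero (kernel (0 : X ⟶ Y)) := hX.of_iso kernelZeroIsoSource
  rw [coneClass, hφ.map_isZero hk (P.prop_of_isZero hk), sub_zero]
  exact hφ.map_iso cokernelZeroIsoTarget (P.prop_of_iso cokernelZeroIsoTarget.symm hY) hY

lemma coneClass_comp_iso {X X' Y : C} (e : X ≅ X') (f : X' ⟶ Y) (hk : P (kernel f))
    (hc : P (cokernel f)) : coneClass φ (e.hom ≫ f) = coneClass φ f := by
  have ek : kernel (e.hom ≫ f) ≅ kernel f := kernelIsIsoComp e.hom f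
  have ec : cokernel (e.hom ≫ f) ≅ cokernel f := cokernelEpiComp e.hom f
  rw [coneClass, coneClass, hφ.map_iso ek (P.prop_of_iso ek.symm hk) hk,
    hφ.map_iso ec (P.prop_of_iso ec.symm hc) hc]

end Cone

end IsAdditiveOn

end Additive

/-! ### Grothendieck groups of full subcategories -/

section K0On

variable (P : ObjectProperty C)

/-- The subgroup of the free abelian group on the objects of `P` generated by the relations
`[X₂] - [X₁] - [X₃]` for the ambient short exact sequences with terms in `P`. -/
def relationsOn : AddSubgroup (FreeAbelianGroup P.FullSubcategory) :=
  AddSubgroup.closure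
    {x | ∃ (S : ShortComplex C) (h₁ : P S.X₁) (h₂ : P S.X₂) (h₃ : P S.X₃), S.ShortExact ∧
      x = FreeAbelianGroup.of ⟨S.X₂, h₂⟩ - FreeAbelianGroup.of ⟨S.X₁, h₁⟩ -
        FreeAbelianGroup.of ⟨S.X₃, h₃⟩}

/-- The Grothendieck group of a full subcategory `P` of an abelian category, with respect to the
ambient short exact sequences. It makes sense whether or not `P` is abelian. -/
abbrev K0On : Type u := FreeAbelianGroup P.FullSubcategory ⧸ relationsOn P

open Classical in
/-- The class of `X` in `K0On P`, with the junk value `0` if `X` does not satisfy `P`. -/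
def cls (X : C) : K0On P :=
  if hX : P X then QuotientAddGroup.mk (FreeAbelianGroup.of ⟨X, hX⟩) else 0

variable {P}

lemma cls_of_prop {X : C} (hX : P X) :
    cls P X = QuotientAddGroup.mk (FreeAbelianGroup.of ⟨X, hX⟩) :=
  dif_pos hX

lemma isAdditiveOn_cls : IsAdditiveOn P (cls P) := by
  intro S hS h₁ h₂ h₃
  rw [cls_of_prop h₁, cls_of_prop h₂, cls_of_prop h₃, ← sub_eq_zero, ← sub_sub]
  exact (QuotientAddGroup.eq_zero_iff _).2 (AddSubgroup.subset_closure ⟨S, h₁, h₂, h₃, hS, rfl⟩)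

namespace K0On

/-- The homomorphism out of `K0On P` induced by a function that is additive on `P`. -/
def lift {G : Type*} [AddCommGroup G] (φ : C → G) (hφ : IsAdditiveOn P φ) : K0On P →+ G :=
  QuotientAddGroup.lift _ (FreeAbelianGroup.lift fun X => φ X.obj) (by
    rw [relationsOn, AddSubgroup.closure_le]
    rintro _ ⟨S, h₁, h₂, h₃, hS, rfl⟩
    simp [hφ S hS h₁ h₂ h₃])

lemma lift_cls {G : Type*} [AddCommGroup G] (φ : C → G) (hφ : IsAdditiveOn P φ) {X : C}
    (hX : P X) : lift φ hφ (cls P X) = φ X := by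
  simp [cls_of_prop hX, lift]

lemma hom_ext {G : Type*} [AddCommGroup G] {f g : K0On P →+ G}
    (h : ∀ X, P X → f (cls P X) = g (cls P X)) : f = g := by
  refine QuotientAddGroup.addMonoidHom_ext _ (FreeAbelianGroup.lift_ext _ _ fun X => ?_)
  have := h X.obj X.property
  rwa [cls_of_prop X.property] at this

lemma eq_top_of_cls_mem {H : AddSubgroup (K0On P)} (h : ∀ X, P X → cls P X ∈ H) : H = ⊤ := by
  have h₀ : QuotientAddGroup.mk' H = 0 :=
    hom_ext fun X hX => (QuotientAddGroup.eq_zero_iff _).2 (h X hX)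
  exact eq_top_iff.2 fun x _ => (QuotientAddGroup.eq_zero_iff x).1 (DFunLike.congr_fun h₀ x)

/-- The homomorphism of Grothendieck groups induced by an inclusion of full subcategories. -/
def map {P' : ObjectProperty C} (h : P ≤ P') : K0On P →+ K0On P' :=
  lift (cls P') (isAdditiveOn_cls.mono h)

lemma map_cls {P' : ObjectProperty C} (h : P ≤ P') {X : C} (hX : P X) :
    map h (cls P X) = cls P' X :=
  lift_cls _ _ hX

end K0On

end K0On

/-! ### Coresolutions of length one -/

section Pushout

variable {S : ShortComplex C} (hS : S.ShortExact) {Y W : C} {h : S.X₁ ⟶ Y} {j : S.X₂ ⟶ Y}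

include hS

lemma shortExact_of_isPushout_f {b : S.X₂ ⟶ W} {r : Y ⟶ W} (sq : IsPushout S.f h b r) :
    (ShortComplex.mk r (sq.desc S.g 0 (by simp)) (by simp)).ShortExact := by
  have := hS.mono_f
  have := hS.epi_g
  have hr : Mono r := MorphismProperty.of_isPushout (P := .monomorphisms C) sq.flip ‹Mono S.f›
  have hg : Epi (b ≫ sq.desc S.g 0 (by simp)) := by
    rw [sq.inl_desc]
    infer_instance
  refine { exact := ShortComplex.exact_of_g_is_cokernel _ ?_, epi_g := epi_of_epi b _ }
  have hk {Z : C} (k : W ⟶ Z) (hk : r ≫ k = 0) : S.f ≫ b ≫ k = 0 := by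
    rw [sq.w_assoc, hk, comp_zero]
  refine CokernelCofork.IsColimit.ofπ _ _ (fun k w => hS.exact.desc (b ≫ k) (hk k w))
    (fun k w => ?_) fun k w m hm => ?_
  · refine sq.hom_ext ?_ ?_
    · rw [sq.inl_desc_assoc, hS.exact.g_desc]
    · rw [sq.inr_desc_assoc, zero_comp, w]
  · rw [← cancel_epi S.g, hS.exact.g_desc, ← hm, sq.inl_desc_assoc]

lemma shortExact_of_isPushout_g [Mono j] {b : S.X₃ ⟶ W} {r : Y ⟶ W} (sq : IsPushout S.g j b r) :
    (ShortComplex.mk (S.f ≫ j) r (by rw [Category.assoc, ← sq.w, S.zero_assoc,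
      zero_comp])).ShortExact := by
  have := hS.mono_f
  have := hS.epi_g
  have hr : Epi r := MorphismProperty.of_isPushout (P := .epimorphisms C) sq.flip ‹Epi S.g›
  refine { exact := ShortComplex.exact_of_g_is_cokernel _ ?_, mono_f := mono_comp S.f j }
  have hk {Z : C} (k : Y ⟶ Z) (hk : (S.f ≫ j) ≫ k = 0) : S.f ≫ j ≫ k = 0 := by
    rw [← Category.assoc, hk]
  refine CokernelCofork.IsColimit.ofπ _ _
    (fun k w => sq.desc (hS.exact.desc (j ≫ k) (hk k w)) k (hS.exact.g_desc _ _))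
    (fun k w => sq.inr_desc _ _ _) fun k w m hm => ?_
  rw [← cancel_epi r, sq.inr_desc, hm]

end Pushout

/-- `P₁` is a coresolving subcategory of `P` in which every object of `P` has a coresolution of
length one: it is closed under quotients in `P` and every object of `P` embeds in an object of
`P₁`. -/
structure IsCoresolving (P P₁ : ObjectProperty C) : Prop where
  le : P₁ ≤ P
  prop_of_epi {X Y : C} (f : X ⟶ Y) [Epi f] (hX : P₁ X) (hY : P Y) : P₁ Y
  exists_mono (X : C) (hX : P X) : ∃ (Y : C) (f : X ⟶ Y), Mono f ∧ P₁ Y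

lemma IsAdditiveOn.sub_eq_sub_of_shortExact {P : ObjectProperty C} [P.IsClosedUnderExtensions]
    {G : Type*} [AddCommGroup G] {φ : C → G} (hφ : IsAdditiveOn P φ) {X Y Z Y' Z' : C}
    {f : X ⟶ Y} {g : Y ⟶ Z} {f' : X ⟶ Y'} {g' : Y' ⟶ Z'} {w : f ≫ g = 0} {w' : f' ≫ g' = 0}
    (hS : (ShortComplex.mk f g w).ShortExact) (hS' : (ShortComplex.mk f' g' w').ShortExact)
    (hY : P Y) (hZ : P Z) (hY' : P Y') (hZ' : P Z') : φ Y - φ Z = φ Y' - φ Z' := by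
  have sq := IsPushout.of_hasPushout f f'
  have hr := shortExact_of_isPushout_f hS sq
  have hr' := shortExact_of_isPushout_f hS' sq.flip
  have hW : P (pushout f f') := P.prop_X₂_of_shortExact hr hY' hZ
  have e : φ (pushout f f') = φ Y' + φ Z := hφ _ hr hY' hW hZ
  have e' : φ (pushout f f') = φ Y + φ Z' := hφ _ hr' hY hW hZ'
  rw [sub_eq_sub_iff_add_eq_add, ← e', e]

namespace IsCoresolving

variable {P P₁ : ObjectProperty C} [P.IsClosedUnderCokernels] (h : IsCoresolving P P₁)

include h

lemma exists_shortExact (X : C) (hX : P X) :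
    ∃ (Y Z : C) (f : X ⟶ Y) (g : Y ⟶ Z) (w : f ≫ g = 0),
      (ShortComplex.mk f g w).ShortExact ∧ P₁ Y ∧ P₁ Z := by
  obtain ⟨Y, f, _, hY⟩ := h.exists_mono X hX
  exact ⟨Y, _, f, _, _, shortExact_cokernel f, hY,
    h.prop_of_epi (cokernel.π f) hY (P.prop_cokernel f hX (h.le _ hY))⟩

variable [P.IsClosedUnderExtensions] [P₁.IsClosedUnderExtensions] [P₁.ContainsZero]

lemma exists_extension {G : Type*} [AddCommGroup G] {φ : C → G} (hφ : IsAdditiveOn P₁ φ) :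
    ∃ ψ : C → G, IsAdditiveOn P ψ ∧ ∀ X, P₁ X → ψ X = φ X := by
  classical
  choose! E Z i p w hE hPE hPZ using h.exists_shortExact
  have sub_eq {X Y Y' : C} {f : X ⟶ Y} {g : Y ⟶ Y'} {w : f ≫ g = 0}
      (hS : (ShortComplex.mk f g w).ShortExact) (hX : P X) (hY : P₁ Y) (hY' : P₁ Y') :
      φ (E X) - φ (Z X) = φ Y - φ Y' :=
    hφ.sub_eq_sub_of_shortExact (hE X hX) hS (hPE X hX) (hPZ X hX) hY hY'
  refine ⟨fun X => φ (E X) - φ (Z X), fun S hS h₁ h₂ h₃ => ?_, fun X hX => ?_⟩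
  · have := (hE _ h₂).mono_f
    have sq := IsPushout.of_hasPushout S.g (i S.X₂)
    have hS₁ := shortExact_of_isPushout_g hS sq
    have hS₃ := shortExact_of_isPushout_f (hE _ h₂) sq.flip
    have hQ : P₁ (pushout S.g (i S.X₂)) :=
      have := hS₁.epi_g
      h.prop_of_epi (pushout.inr S.g (i S.X₂)) (hPE _ h₂)
        (P.prop_X₂_of_shortExact hS₃ h₃ (h.le _ (hPZ _ h₂)))
    dsimp only
    rw [sub_eq hS₁ h₁ (hPE _ h₂) hQ, sub_eq hS₃ h₃ hQ (hPZ _ h₂)]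
    abel
  · obtain ⟨O, hO, hPO⟩ := P₁.exists_prop_of_containsZero
    dsimp only
    rw [sub_eq (shortExact_iso_zero (Iso.refl X) hO) (h.le _ hX) hX hPO, hφ.map_isZero hO hPO,
      sub_zero]

theorem bijective_map : Function.Bijective (K0On.map h.le) := by
  constructor
  · obtain ⟨ψ, hψ, hψ_eq⟩ := h.exists_extension isAdditiveOn_cls
    have hretract : (K0On.lift ψ hψ).comp (K0On.map h.le) = AddMonoidHom.id _ :=
      K0On.hom_ext fun X hX => by
        rw [AddMonoidHom.comp_apply, K0On.map_cls h.le hX, K0On.lift_cls ψ hψ (h.le _ hX),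
          hψ_eq X hX, AddMonoidHom.id_apply]
    exact Function.LeftInverse.injective (g := K0On.lift ψ hψ) (DFunLike.congr_fun hretract)
  · refine AddMonoidHom.range_eq_top.1 (K0On.eq_top_of_cls_mem fun X hX => ?_)
    obtain ⟨Y, Z, f, g, w, hS, hY, hZ⟩ := h.exists_shortExact X hX
    have e : cls P Y = cls P X + cls P Z := isAdditiveOn_cls _ hS hX (h.le _ hY) (h.le _ hZ)
    refine ⟨cls P₁ Y - cls P₁ Z, ?_⟩
    rw [map_sub, K0On.map_cls h.le hY, K0On.map_cls h.le hZ, e, add_sub_cancel_right]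

end IsCoresolving

/-! ### Coreflections in the powers of an object -/

section Power

variable {T : C}

/-- `IsPower T n F` says that `F` is a direct sum of `n` copies of `T`. -/
def IsPower (T : C) (n : ℕ) (F : C) : Prop :=
  Nonempty (F ≅ ⨁ fun _ : Fin n => T)

namespace IsPower

lemma biproduct (T : C) (n : ℕ) : IsPower T n (⨁ fun _ : Fin n => T) :=
  ⟨Iso.refl _⟩

lemma zero (T : C) {F : C} (hF : IsZero F) : IsPower T 0 F :=
  ⟨hF.iso ((IsZero.iff_id_eq_zero _).2 (biproduct.hom_ext _ _ fun i => i.elim0))⟩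

lemma one (T : C) : IsPower T 1 T :=
  ⟨(biproductUniqueIso fun _ : Fin 1 => T).symm⟩

variable {a b n : ℕ} {F G : C}

lemma biprod (hF : IsPower T a F) (hG : IsPower T b G) : IsPower T (a + b) (F ⊞ G) := by
  obtain ⟨e⟩ := hF
  obtain ⟨e'⟩ := hG
  refine ⟨biprod.mapIso e e' ≪≫ ⟨biprod.desc
    (biproduct.desc fun i => biproduct.ι (fun _ : Fin (a + b) => T) (Fin.castAdd b i))
    (biproduct.desc fun j => biproduct.ι (fun _ : Fin (a + b) => T) (Fin.natAdd a j)),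
    biproduct.desc (Fin.addCases (fun i => biproduct.ι (fun _ : Fin a => T) i ≫ biprod.inl)
      fun j => biproduct.ι (fun _ : Fin b => T) j ≫ biprod.inr), ?_, ?_⟩⟩
  · ext <;> simp
  · refine biproduct.hom_ext' _ _ fun i => ?_
    induction i using Fin.addCases <;> simp

lemma nonempty_iso (hF : IsPower T n F) (hG : IsPower T n G) : Nonempty (F ≅ G) := by
  obtain ⟨e⟩ := hF
  obtain ⟨e'⟩ := hG
  exact ⟨e ≪≫ e'.symm⟩

lemma nonempty_iso_biprod (hF : IsPower T (n + 1) F) :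
    ∃ G : C, IsPower T n G ∧ Nonempty (F ≅ G ⊞ T) :=
  ⟨_, biproduct T n, hF.nonempty_iso ((biproduct T n).biprod (one T))⟩

lemma isZero (hF : IsPower T 0 F) : IsZero F := by
  obtain ⟨e⟩ := hF.nonempty_iso (zero T (isZero_zero C))
  exact (isZero_zero C).of_iso e

section Additive

variable {P : ObjectProperty C} [P.ContainsZero] [P.IsClosedUnderExtensions] (hT : P T)

include hT

lemma prop (hF : IsPower T n F) : P F := by
  induction n generalizing F with
  | zero => exact P.prop_of_isZero hF.isZero
  | succ n ih =>
    obtain ⟨G, hG, ⟨e⟩⟩ := hF.nonempty_iso_biprod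
    exact P.prop_of_iso e.symm (P.prop_biprod (ih hG) hT)

lemma map_eq_nsmul {A : Type*} [AddCommGroup A] {φ : C → A} (hφ : IsAdditiveOn P φ)
    (hF : IsPower T n F) : φ F = n • φ T := by
  induction n generalizing F with
  | zero => rw [hφ.map_isZero hF.isZero (hF.prop hT), zero_smul]
  | succ n ih =>
    obtain ⟨G, hG, ⟨e⟩⟩ := hF.nonempty_iso_biprod
    rw [hφ.map_iso e (hF.prop hT) (P.prop_biprod (hG.prop hT) hT),
      hφ.map_biprod (hG.prop hT) hT, ih hG, succ_nsmul]

end Additive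

section Hom

lemma exists_comp_eq {X Y : C} (f : X ⟶ Y) (hf : ∀ u : T ⟶ Y, ∃ v, v ≫ f = u)
    (hF : IsPower T n F) (u : F ⟶ Y) : ∃ v, v ≫ f = u := by
  obtain ⟨e⟩ := hF
  choose v hv using fun i => hf (biproduct.ι (fun _ : Fin n => T) i ≫ e.inv ≫ u)
  refine ⟨e.hom ≫ biproduct.desc v, ?_⟩
  rw [Category.assoc, ← Iso.eq_inv_comp]
  exact biproduct.hom_ext' _ _ fun i => by simp [hv]

lemma eq_zero_of_comp_eq_zero {X Y : C} (f : X ⟶ Y) (hf : ∀ u : T ⟶ X, u ≫ f = 0 → u = 0)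
    (hF : IsPower T n F) (u : F ⟶ X) (hu : u ≫ f = 0) : u = 0 := by
  obtain ⟨e⟩ := hF
  rw [← cancel_epi e.inv, comp_zero]
  refine biproduct.hom_ext' _ _ fun i => ?_
  rw [comp_zero]
  exact hf (biproduct.ι (fun _ : Fin n => T) i ≫ e.inv ≫ u) (by simp [hu])

/-- `Hom(T, Tⁿ)` is a free right module of rank `n` over `End T`. Right modules are encoded as
left modules over the opposite ring. -/
def homBiproductEquiv (T : C) (n : ℕ) :
    (T ⟶ ⨁ fun _ : Fin n => T) ≃ₗ[(End T)ᵐᵒᵖ] (Fin n → (End T)ᵐᵒᵖ) where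
  toFun u i := MulOpposite.op (u ≫ biproduct.π _ i)
  invFun c := biproduct.lift fun i => (c i).unop
  map_add' u v := by ext; simp
  map_smul' c u := by
    ext i
    exact congrArg MulOpposite.op (Category.assoc _ _ _)
  left_inv u := biproduct.hom_ext _ _ fun i => biproduct.lift_π _ i
  right_inv c := funext fun i => congrArg MulOpposite.op (biproduct.lift_π _ i)

lemma eq_of_iso [InvariantBasisNumber (End T)ᵐᵒᵖ] (hF : IsPower T a F) (hG : IsPower T b G)
    (e : F ≅ G) : a = b := by
  obtain ⟨eF⟩ := hF
  obtain ⟨eG⟩ := hG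
  let i : (⨁ fun _ : Fin a => T) ≅ ⨁ fun _ : Fin b => T := eF.symm ≪≫ e ≪≫ eG
  let postcomp : (T ⟶ ⨁ fun _ : Fin a => T) ≃ₗ[(End T)ᵐᵒᵖ] (T ⟶ ⨁ fun _ : Fin b => T) :=
    { i.homToEquiv with
      map_add' := fun u v => Preadditive.add_comp _ _ _ u v i.hom
      map_smul' := fun c u => Category.assoc _ _ _ }
  exact InvariantBasisNumber.eq_of_fin_equiv
    ((homBiproductEquiv T a).symm ≪≫ₗ postcomp ≪≫ₗ homBiproductEquiv T b)

end Hom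

end IsPower

/-- `f : F ⟶ X` is a coreflection of `X` in the powers of `T`: the object `F` is a direct sum of
`n` copies of `T` and every `T ⟶ X` factors uniquely through `f`. -/
structure IsCoreflection (T : C) (n : ℕ) {F X : C} (f : F ⟶ X) : Prop where
  isPower : IsPower T n F
  eq_zero (u : T ⟶ F) (hu : u ≫ f = 0) : u = 0
  exists_lift (u : T ⟶ X) : ∃ v, v ≫ f = u

namespace IsCoreflection

lemma id (T : C) : IsCoreflection T 1 (𝟙 T) where
  isPower := .one T
  eq_zero u hu := by simpa using hu
  exists_lift u := ⟨u, Category.comp_id u⟩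

lemma biproduct_desc {X : C} {n : ℕ} (g : Module.Basis (Fin n) (End T)ᵐᵒᵖ (T ⟶ X)) :
    IsCoreflection T n (biproduct.desc g) where
  isPower := .biproduct T n
  eq_zero u hu := by
    have hu' : ∑ i, IsPower.homBiproductEquiv T n u i • g i = 0 := by
      rw [← hu, biproduct.desc_eq, Preadditive.comp_sum]
      exact Finset.sum_congr rfl fun i _ => Category.assoc _ _ _
    rw [← (IsPower.homBiproductEquiv T n).map_eq_zero_iff]
    exact funext (Fintype.linearIndependent_iff.1 g.linearIndependent _ hu')
  exists_lift u := ⟨biproduct.lift fun i => (g.repr u i).unop,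
    biproduct.lift_desc.trans (g.sum_repr u)⟩

lemma of_forall_eq_zero {F X : C} (hF : IsZero F) (h : ∀ u : T ⟶ X, u = 0) (f : F ⟶ X) :
    IsCoreflection T 0 f where
  isPower := .zero T hF
  eq_zero _ _ := hF.eq_of_tgt _ _
  exists_lift u := ⟨0, by rw [zero_comp, h u]⟩

lemma biprod_desc {a b : ℕ} {S : ShortComplex C} (hS : S.ShortExact) {F₁ F₃ : C} {f₁ : F₁ ⟶ S.X₁}
    {f₃ : F₃ ⟶ S.X₃} (h₁ : IsCoreflection T a f₁) (h₃ : IsCoreflection T b f₃) (s : F₃ ⟶ S.X₂)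
    (hs : s ≫ S.g = f₃) : IsCoreflection T (a + b) (biprod.desc (f₁ ≫ S.f) s) where
  isPower := h₁.isPower.biprod h₃.isPower
  eq_zero u hu := by
    have := hS.mono_f
    have hu' : (u ≫ biprod.fst) ≫ f₁ ≫ S.f + (u ≫ biprod.snd) ≫ s = 0 := by
      rw [← biprod.lift_desc, ← hu]
      congr 1
      ext <;> simp
    have h_snd : u ≫ biprod.snd = 0 := h₃.eq_zero _ (by simpa [hs] using hu' =≫ S.g)
    have h_fst : u ≫ biprod.fst = 0 := h₁.eq_zero _ (by
      rw [← cancel_mono S.f]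
      simpa [h_snd] using hu')
    exact biprod.hom_ext _ _ (by rw [h_fst, zero_comp]) (by rw [h_snd, zero_comp])
  exists_lift u := by
    have := hS.mono_f
    obtain ⟨v₃, hv₃⟩ := h₃.exists_lift (u ≫ S.g)
    obtain ⟨v₁, hv₁⟩ := h₁.exists_lift (hS.exact.lift (u - v₃ ≫ s) (by simp [hs, hv₃]))
    refine ⟨biprod.lift v₁ v₃, ?_⟩
    rw [biprod.lift_desc, reassoc_of% hv₁, hS.exact.lift_f, sub_add_cancel]

lemma exists_iso {a b : ℕ} {F F' X : C} {f : F ⟶ X} {f' : F' ⟶ X} (hf : IsCoreflection T a f)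
    (hf' : IsCoreflection T b f') : ∃ e : F ≅ F', e.hom ≫ f' = f := by
  obtain ⟨v, hv⟩ := hf.isPower.exists_comp_eq f' hf'.exists_lift f
  obtain ⟨v', hv'⟩ := hf'.isPower.exists_comp_eq f hf.exists_lift f'
  refine ⟨⟨v, v', ?_, ?_⟩, hv⟩
  · rw [← sub_eq_zero]
    exact hf.isPower.eq_zero_of_comp_eq_zero f hf.eq_zero _ (by simp [hv, hv'])
  · rw [← sub_eq_zero]
    exact hf'.isPower.eq_zero_of_comp_eq_zero f' hf'.eq_zero _ (by simp [hv, hv'])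

end IsCoreflection

section DivisionRing

variable [Nontrivial (End T)] (hT : ∀ f : End T, f ≠ 0 → IsUnit f)

/-- The opposite of the endomorphism ring of `T`, as a division ring. -/
abbrev divisionRingEnd : DivisionRing (End T)ᵐᵒᵖ :=
  DivisionRing.ofIsUnitOrEqZero fun f =>
    (eq_or_ne f 0).symm.imp_left fun hf => (hT f.unop (by simpa using hf)).op

include hT

lemma exists_isCoreflection (X : C) [Module.Finite (End T)ᵐᵒᵖ (T ⟶ X)] :
    ∃ (n : ℕ) (F : C) (f : F ⟶ X), IsCoreflection T n f :=
  letI := divisionRingEnd hT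
  ⟨_, _, _, .biproduct_desc (Module.finBasis (End T)ᵐᵒᵖ (T ⟶ X))⟩

lemma invariantBasisNumber_end : InvariantBasisNumber (End T)ᵐᵒᵖ :=
  letI := divisionRingEnd hT
  inferInstance

end DivisionRing

end Power

section Inf

variable (P Q : ObjectProperty C)

instance isClosedUnderExtensions_inf [P.IsClosedUnderExtensions] [Q.IsClosedUnderExtensions] :
    (P ⊓ Q).IsClosedUnderExtensions where
  prop_X₂_of_shortExact hS h₁ h₃ :=
    ⟨P.prop_X₂_of_shortExact hS h₁.1 h₃.1, Q.prop_X₂_of_shortExact hS h₁.2 h₃.2⟩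

instance isWide_inf [IsWide P] [IsWide Q] : IsWide (P ⊓ Q) where
  kernels_le := by
    rintro _ ⟨f, k, hk, hf⟩
    exact ⟨P.prop_of_isLimit_kernelFork hk hf.1.1 hf.2.1,
      Q.prop_of_isLimit_kernelFork hk hf.1.2 hf.2.2⟩
  cokernels_le := by
    rintro _ ⟨f, k, hk, hf⟩
    exact ⟨P.prop_of_isColimit_cokernelCofork hk hf.1.1 hf.2.1,
      Q.prop_of_isColimit_cokernelCofork hk hf.1.2 hf.2.2⟩

end Inf

/-! ### Perpendicular subcategories -/

section Perpendicular

variable [HasExt.{w} C]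

section Acyclic

/-- The objects `X` with `Ext¹(T, X) = 0`. -/
def extOneAcyclic (T : C) : ObjectProperty C :=
  fun X => Subsingleton (Ext.{w} T X 1)

variable (T : C)

lemma subsingleton_ext_of_shortExact {S : ShortComplex C} (hS : S.ShortExact) {i : ℕ}
    (h₁ : Subsingleton (Ext.{w} T S.X₁ i)) (h₃ : Subsingleton (Ext.{w} T S.X₃ i)) :
    Subsingleton (Ext.{w} T S.X₂ i) := by
  rw [ext_subsingleton_iff]
  intro x
  obtain ⟨y, rfl⟩ := Ext.covariant_sequence_exact₂ T hS x (Subsingleton.elim _ _)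
  rw [Subsingleton.elim y 0, Ext.zero_comp]

instance : (rightPerp.{w} T).IsClosedUnderExtensions where
  prop_X₂_of_shortExact hS h₁ h₃ i := subsingleton_ext_of_shortExact T hS (h₁ i) (h₃ i)

instance : (extOneAcyclic.{w} T).IsClosedUnderExtensions where
  prop_X₂_of_shortExact hS h₁ h₃ := subsingleton_ext_of_shortExact T hS h₁ h₃

lemma rightPerp_le_extOneAcyclic : rightPerp.{w} T ≤ extOneAcyclic.{w} T :=
  fun _ hX => hX 1

instance : (extOneAcyclic.{w} T).ContainsZero where
  exists_zero := by
    obtain ⟨Z, hZ, hTZ⟩ := (rightPerp.{w} T).exists_prop_of_containsZero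
    exact ⟨Z, hZ, rightPerp_le_extOneAcyclic T _ hTZ⟩

variable {T}

lemma eq_zero_of_rightPerp {X : C} (hX : rightPerp.{w} T X) (u : T ⟶ X) : u = 0 :=
  (Ext.mk₀_bijective T X).1 ((hX 0).elim _ _)

lemma exists_comp_eq_of_extOneAcyclic {S : ShortComplex C} (hS : S.ShortExact)
    (h₁ : extOneAcyclic.{w} T S.X₁) (u : T ⟶ S.X₃) : ∃ v, v ≫ S.g = u := by
  obtain ⟨y, hy⟩ := Ext.covariant_sequence_exact₃ T hS (Ext.mk₀ u) rfl (h₁.elim _ _)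
  obtain ⟨v, rfl⟩ := (Ext.mk₀_bijective T _).2 y
  exact ⟨v, (Ext.mk₀_bijective T _).1 (by rw [← hy, Ext.mk₀_comp_mk₀])⟩

lemma extOneAcyclic_of_forall_exists_comp_eq {S : ShortComplex C} (hS : S.ShortExact)
    (h₂ : extOneAcyclic.{w} T S.X₂) (h : ∀ u : T ⟶ S.X₃, ∃ v, v ≫ S.g = u) :
    extOneAcyclic.{w} T S.X₁ := by
  rw [extOneAcyclic, ext_subsingleton_iff]
  intro x
  obtain ⟨y, rfl⟩ := Ext.covariant_sequence_exact₁ T hS x (h₂.elim _ _) rfl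
  obtain ⟨u, rfl⟩ := (Ext.mk₀_bijective T _).2 y
  obtain ⟨v, rfl⟩ := h u
  rw [← Ext.mk₀_comp_mk₀, Ext.comp_assoc_of_second_deg_zero, hS.comp_extClass, Ext.comp_zero]

section ProjectiveDimension

variable [HasProjectiveDimensionLE T 1]

instance : IsWide (rightPerp.{w} T) where

lemma extOneAcyclic_of_epi {X Y : C} (f : X ⟶ Y) [Epi f] (hX : extOneAcyclic.{w} T X) :
    extOneAcyclic.{w} T Y := by
  have hS : (ShortComplex.mk (kernel.ι f) f (kernel.condition f)).ShortExact :=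
    { exact := ShortComplex.exact_kernel f }
  rw [extOneAcyclic, ext_subsingleton_iff]
  intro x
  obtain ⟨y, rfl⟩ := Ext.covariant_sequence_exact₃ T hS x rfl
    (Ext.eq_zero_of_hasProjectiveDimensionLT _ 2 le_rfl)
  rw [hX.elim y 0, Ext.zero_comp]

lemma rightPerp_of_extOneAcyclic {X : C} (h₀ : ∀ u : T ⟶ X, u = 0)
    (h₁ : extOneAcyclic.{w} T X) : rightPerp.{w} T X
  | 0 => ext_subsingleton_iff.2 fun x => by
    obtain ⟨u, rfl⟩ := (Ext.mk₀_bijective T X).2 x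
    rw [h₀ u, Ext.mk₀_zero]
  | 1 => h₁
  | i + 2 => ext_subsingleton_iff.2 fun x =>
    Ext.eq_zero_of_hasProjectiveDimensionLT x 2 (Nat.le_add_left 2 i)

end ProjectiveDimension

end Acyclic

section UniversalExtension

variable {T : C} (k : Type t) [CommRing k] [Linear k C]

lemma exists_shortExact_forall_comp_mk₀_eq_zero {X : C} [Module.Finite k (Ext.{w} T X 1)] :
    ∃ (m : ℕ) (E : C) (f : X ⟶ E) (g : E ⟶ ⨁ fun _ : Fin m => T) (w : f ≫ g = 0),
      (ShortComplex.mk f g w).ShortExact ∧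
      ∀ x : Ext.{w} T X 1, x.comp (Ext.mk₀ f) (add_zero 1) = 0 := by
  obtain ⟨m, s, hs⟩ := Module.Finite.exists_fin (R := k) (M := Ext.{w} T X 1)
  let equiv := Ext.biproductAddEquiv.{w} (biproduct.isBilimit fun _ : Fin m => T) X 1
  obtain ⟨E, f, g, w, hS, hf⟩ := exists_shortExact_comp_mk₀_eq_zero (equiv.symm s)
  have hs_comp (i : Fin m) : (s i).comp (Ext.mk₀ f) (add_zero 1) = 0 := by
    have hi : (Ext.mk₀ (biproduct.ι _ i)).comp (equiv.symm s) (zero_add 1) = s i :=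
      congrFun (equiv.apply_symm_apply s) i
    rw [← hi, Ext.comp_assoc_of_third_deg_zero, hf, Ext.comp_zero]
  have hker : ⊤ ≤ LinearMap.ker ((Ext.mk₀ f).postcompOfLinear k T (add_zero 1)) := by
    rw [← hs, Submodule.span_le]
    rintro _ ⟨i, rfl⟩
    exact hs_comp i
  exact ⟨m, E, f, g, w, hS, fun x => hker (Submodule.mem_top (x := x))⟩

variable {P : ObjectProperty C} [P.ContainsZero] [P.IsClosedUnderExtensions]

lemma exists_mono_extOneAcyclic (hPT : P T) (hT : extOneAcyclic.{w} T T) {X : C} (hX : P X)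
    [Module.Finite k (Ext.{w} T X 1)] :
    ∃ (Y : C) (f : X ⟶ Y), Mono f ∧ (P ⊓ extOneAcyclic.{w} T) Y := by
  obtain ⟨m, E, f, g, w, hS, hf⟩ := exists_shortExact_forall_comp_mk₀_eq_zero (T := T) (X := X) k
  refine ⟨E, f, hS.mono_f,
    P.prop_X₂_of_shortExact hS hX ((IsPower.biproduct T m).prop hPT), ?_⟩
  have hTm : extOneAcyclic.{w} T (⨁ fun _ : Fin m => T) := (IsPower.biproduct T m).prop hT
  rw [extOneAcyclic, ext_subsingleton_iff]
  intro x
  obtain ⟨y, rfl⟩ := Ext.covariant_sequence_exact₂ T hS x (hTm.elim _ _)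
  exact hf y

end UniversalExtension

lemma isCoresolving_extOneAcyclic (k : Type t) [CommRing k] [Linear k C] {P : ObjectProperty C}
    [P.ContainsZero] [P.IsClosedUnderExtensions] {T : C} [HasProjectiveDimensionLE T 1]
    (hPT : P T) (hT : extOneAcyclic.{w} T T) [∀ X, Module.Finite k (Ext.{w} T X 1)] :
    IsCoresolving P (P ⊓ extOneAcyclic.{w} T) where
  le := inf_le_left
  prop_of_epi f _ hX hY := ⟨hY, extOneAcyclic_of_epi f hX.2⟩
  exists_mono _ hX := exists_mono_extOneAcyclic k hPT hT hX

section Coreflection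

variable {P : ObjectProperty C} {T : C}

namespace IsCoreflection

variable [HasProjectiveDimensionLE T 1]

section Membership

variable {n : ℕ} {F X : C} {f : F ⟶ X} (hT : extOneAcyclic.{w} T T) (hf : IsCoreflection T n f)

include hT hf

lemma extOneAcyclic_image : extOneAcyclic.{w} T (Abelian.image f) :=
  extOneAcyclic_of_epi (Abelian.factorThruImage f) (hf.isPower.prop hT)

lemma rightPerp_kernel : rightPerp.{w} T (kernel f) := by
  refine rightPerp_of_extOneAcyclic (fun u => ?_) (extOneAcyclic_of_forall_exists_comp_eq
    (shortExact_kernel_image f) (hf.isPower.prop hT) fun u => ?_)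
  · rw [← cancel_mono (kernel.ι f), zero_comp]
    exact hf.eq_zero _ (by simp)
  · obtain ⟨v, hv⟩ := hf.exists_lift (u ≫ Abelian.image.ι f)
    exact ⟨v, by simp [← cancel_mono (Abelian.image.ι f), hv]⟩

lemma rightPerp_cokernel (hX : extOneAcyclic.{w} T X) : rightPerp.{w} T (cokernel f) := by
  refine rightPerp_of_extOneAcyclic (fun u => ?_) (extOneAcyclic_of_epi (cokernel.π f) hX)
  obtain ⟨v, rfl⟩ := exists_comp_eq_of_extOneAcyclic (shortExact_image_cokernel f)
    (hf.extOneAcyclic_image hT) u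
  obtain ⟨z, rfl⟩ := hf.exists_lift v
  simp

variable [IsWide P] (hPT : P T)

include hPT

lemma prop_kernel (hX : P X) : (P ⊓ rightPerp.{w} T) (kernel f) :=
  ⟨P.prop_kernel f (hf.isPower.prop hPT) hX, hf.rightPerp_kernel hT⟩

lemma prop_cokernel (hX : (P ⊓ extOneAcyclic.{w} T) X) :
    (P ⊓ rightPerp.{w} T) (cokernel f) :=
  ⟨P.prop_cokernel f (hf.isPower.prop hPT) hX.1, hf.rightPerp_cokernel hT hX.2⟩

lemma prop_image (hX : P X) : (P ⊓ extOneAcyclic.{w} T) (Abelian.image f) :=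
  ⟨ExceptionalCollection.prop_image P f (hf.isPower.prop hPT) hX, hf.extOneAcyclic_image hT⟩

lemma cls_eq (hX : (P ⊓ extOneAcyclic.{w} T) X) :
    cls (P ⊓ extOneAcyclic.{w} T) X =
      n • cls (P ⊓ extOneAcyclic.{w} T) T + coneClass (cls (P ⊓ extOneAcyclic.{w} T)) f := by
  have hle := inf_le_inf_left P (rightPerp_le_extOneAcyclic.{w} T)
  have hPT' : (P ⊓ extOneAcyclic.{w} T) T := ⟨hPT, hT⟩
  rw [isAdditiveOn_cls.coneClass_eq_sub f (hf.isPower.prop hPT') hX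
    (hle _ (hf.prop_kernel hT hPT hX.1)) (hf.prop_image hT hPT hX.1)
    (hle _ (hf.prop_cokernel hT hPT hX)), hf.isPower.map_eq_nsmul hPT' isAdditiveOn_cls,
    add_sub_cancel]

end Membership

variable [IsWide P] {G : Type*} [AddCommGroup G] {φ : C → G} (hPT : P T)
  (hT : extOneAcyclic.{w} T T) (hφ : IsAdditiveOn (P ⊓ rightPerp.{w} T) φ)

include hPT hT hφ

lemma coneClass_eq {a b : ℕ} {F F' X : C} {f : F ⟶ X} {f' : F' ⟶ X} (hf : IsCoreflection T a f)
    (hf' : IsCoreflection T b f') (hX : (P ⊓ extOneAcyclic.{w} T) X) :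
    coneClass φ f = coneClass φ f' := by
  obtain ⟨e, rfl⟩ := hf.exists_iso hf'
  exact hφ.coneClass_comp_iso e f' (hf'.prop_kernel hT hPT hX.1) (hf'.prop_cokernel hT hPT hX)

lemma exists_coneClass_eq_add {S : ShortComplex C} (hS : S.ShortExact)
    (h₁ : (P ⊓ extOneAcyclic.{w} T) S.X₁) (h₂ : (P ⊓ extOneAcyclic.{w} T) S.X₂)
    (h₃ : (P ⊓ extOneAcyclic.{w} T) S.X₃) {a b : ℕ} {F₁ F₃ : C} {f₁ : F₁ ⟶ S.X₁}
    {f₃ : F₃ ⟶ S.X₃} (hf₁ : IsCoreflection T a f₁) (hf₃ : IsCoreflection T b f₃) :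
    ∃ (F₂ : C) (f₂ : F₂ ⟶ S.X₂), IsCoreflection T (a + b) f₂ ∧
      coneClass φ f₂ = coneClass φ f₁ + coneClass φ f₃ := by
  obtain ⟨s, hs⟩ := hf₃.isPower.exists_comp_eq S.g (exists_comp_eq_of_extOneAcyclic hS h₁.2) f₃
  have hf₂ := biprod_desc hS hf₁ hf₃ s hs
  let α : ShortComplex.mk (biprod.inl : F₁ ⟶ F₁ ⊞ F₃) biprod.snd (by simp) ⟶ S :=
    { τ₁ := f₁
      τ₂ := biprod.desc (f₁ ≫ S.f) s
      τ₃ := f₃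
      comm₂₃ := by ext <;> simp [hs] }
  exact ⟨_, _, hf₂, hφ.coneClass_τ₂ α
    (ShortComplex.Splitting.ofHasBinaryBiproduct F₁ F₃).shortExact hS
    (hf₁.prop_kernel hT hPT h₁.1) (hf₂.prop_kernel hT hPT h₂.1) (hf₃.prop_kernel hT hPT h₃.1)
    (hf₁.prop_cokernel hT hPT h₁) (hf₂.prop_cokernel hT hPT h₂) (hf₃.prop_cokernel hT hPT h₃)⟩

end IsCoreflection

section Splitting

variable (P T)

/-- The homomorphism `(m, x) ↦ m • [T] + x`, which splits `ℤ • [T]` off the Grothendieck group of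
the `T`-acyclic objects of `P`. -/
def addPerp : ℤ × K0On (P ⊓ rightPerp.{w} T) →+ K0On (P ⊓ extOneAcyclic.{w} T) :=
  (zmultiplesHom _ (cls _ T)).coprod
    (K0On.map (inf_le_inf_left P (rightPerp_le_extOneAcyclic.{w} T)))

variable {P T}

lemma addPerp_apply (m : ℤ) (x : K0On (P ⊓ rightPerp.{w} T)) :
    addPerp P T (m, x) = m • cls (P ⊓ extOneAcyclic.{w} T) T +
      K0On.map (inf_le_inf_left P (rightPerp_le_extOneAcyclic.{w} T)) x := by
  simp [addPerp]

lemma addPerp_cls (m : ℤ) {X : C} (hX : (P ⊓ rightPerp.{w} T) X) :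
    addPerp P T (m, cls _ X) =
      m • cls (P ⊓ extOneAcyclic.{w} T) T + cls (P ⊓ extOneAcyclic.{w} T) X := by
  rw [addPerp_apply, K0On.map_cls _ hX]

end Splitting

lemma IsExceptional.extOneAcyclic (hT : IsExceptional.{w} T) : extOneAcyclic.{w} T T :=
  hT.ext_eq_zero 1 one_pos

variable [HasProjectiveDimensionLE T 1] [IsWide P] (hPT : P T) (hT : IsExceptional.{w} T)
  [∀ X, Module.Finite (End T)ᵐᵒᵖ (T ⟶ X)]

include hPT hT

lemma exists_isAdditiveOn_coreflection {G : Type*} [AddCommGroup G] {φ : C → G}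
    (hφ : IsAdditiveOn (P ⊓ rightPerp.{w} T) φ) :
    ∃ r : C → ℤ × G, IsAdditiveOn (P ⊓ extOneAcyclic.{w} T) r ∧
      ∀ {X F : C} {n : ℕ} {f : F ⟶ X}, (P ⊓ extOneAcyclic.{w} T) X → IsCoreflection T n f →
        r X = ((n : ℤ), coneClass φ f) := by
  have := hT.nontrivial_end
  have := invariantBasisNumber_end hT.isUnit_of_ne_zero
  have hT₁ := hT.extOneAcyclic
  choose n F f hf using fun X => exists_isCoreflection hT.isUnit_of_ne_zero X
  have r_eq {X F' : C} {m : ℕ} {g : F' ⟶ X} (hX : (P ⊓ extOneAcyclic.{w} T) X)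
      (hg : IsCoreflection T m g) : ((n X : ℤ), coneClass φ (f X)) = ((m : ℤ), coneClass φ g) := by
    obtain ⟨e, -⟩ := (hf X).exists_iso hg
    rw [(hf X).isPower.eq_of_iso hg.isPower e, (hf X).coneClass_eq hPT hT₁ hφ hg hX]
  refine ⟨fun X => (n X, coneClass φ (f X)), fun S hS h₁ h₂ h₃ => ?_, r_eq⟩
  obtain ⟨F₂, f₂, hf₂, h_add⟩ :=
    IsCoreflection.exists_coneClass_eq_add hPT hT₁ hφ hS h₁ h₂ h₃ (hf _) (hf _)
  dsimp only
  rw [r_eq h₂ hf₂, h_add, Nat.cast_add, Prod.mk_add_mk]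

lemma injective_addPerp : Function.Injective (addPerp.{w} P T) := by
  have hT₁ := hT.extOneAcyclic
  obtain ⟨r, hr, r_eq⟩ := exists_isAdditiveOn_coreflection hPT hT isAdditiveOn_cls
  have hle := inf_le_inf_left P (rightPerp_le_extOneAcyclic.{w} T)
  have h_one : K0On.lift r hr (cls _ T) = (1, 0) := by
    rw [K0On.lift_cls r hr ⟨hPT, hT₁⟩, r_eq ⟨hPT, hT₁⟩ (.id T),
      isAdditiveOn_cls.coneClass_of_isIso, Nat.cast_one]
  have h_perp : (K0On.lift r hr).comp (K0On.map hle) = AddMonoidHom.inr _ _ :=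
    K0On.hom_ext fun X hX => by
      rw [AddMonoidHom.comp_apply, K0On.map_cls hle hX, K0On.lift_cls r hr (hle X hX),
        r_eq (hle X hX) (.of_forall_eq_zero (isZero_zero C) (eq_zero_of_rightPerp hX.2) 0),
        isAdditiveOn_cls.coneClass_of_isZero_src _ (isZero_zero C) hX, Nat.cast_zero,
        AddMonoidHom.inr_apply]
  refine Function.LeftInverse.injective (g := K0On.lift r hr) fun ⟨m, x⟩ => ?_
  rw [addPerp_apply, map_add, map_zsmul, h_one, ← AddMonoidHom.comp_apply, h_perp]
  simp

lemma surjective_addPerp : Function.Surjective (addPerp.{w} P T) := by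
  refine AddMonoidHom.range_eq_top.1 (K0On.eq_top_of_cls_mem fun X hX => ?_)
  have := hT.nontrivial_end
  have hT₁ := hT.extOneAcyclic
  obtain ⟨n, F, f, hf⟩ := exists_isCoreflection hT.isUnit_of_ne_zero X
  refine ⟨((n : ℤ), cls _ (cokernel f)) - (0, cls _ (kernel f)), ?_⟩
  rw [map_sub, addPerp_cls _ (hf.prop_cokernel hT₁ hPT hX),
    addPerp_cls _ (hf.prop_kernel hT₁ hPT hX.1), hf.cls_eq hT₁ hPT hX, coneClass, natCast_zsmul,
    zero_smul]
  abel

theorem nonempty_equiv_of_isExceptional (k : Type t) [CommRing k] [Linear k C]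
    [∀ X, Module.Finite k (Ext.{w} T X 1)] :
    Nonempty (K0On P ≃+ ℤ × K0On (P ⊓ rightPerp.{w} T)) :=
  have hres := isCoresolving_extOneAcyclic k hPT hT.extOneAcyclic
  ⟨((AddEquiv.ofBijective _ ⟨injective_addPerp hPT hT, surjective_addPerp hPT hT⟩).trans
    (AddEquiv.ofBijective _ hres.bijective_map)).symm⟩

end Coreflection

end Perpendicular

/-! ### Exceptional collections -/

section FullSubcategory

/-- The Grothendieck group of an abelian category is that of its improper full subcategory. -/
def k0EquivTop : K0 C ≃+ K0On (⊤ : ObjectProperty C) :=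
  QuotientAddGroup.congr _ _ (FreeAbelianGroup.equivOfEquiv
    { toFun := fun X => ⟨X, trivial⟩, invFun := fun X => X.obj,
      left_inv := fun _ => rfl, right_inv := fun _ => rfl }) (by
    rw [shortExactRelations, relationsOn, AddMonoidHom.map_closure]
    congr 1
    ext x
    constructor
    · rintro ⟨_, ⟨S, hS, rfl⟩, rfl⟩
      exact ⟨S, trivial, trivial, trivial, hS, by simp [FreeAbelianGroup.equivOfEquiv]⟩
    · rintro ⟨S, _, _, _, hS, rfl⟩
      exact ⟨_, ⟨S, hS, rfl⟩, by simp [FreeAbelianGroup.equivOfEquiv]⟩)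

variable (P : ObjectProperty C) [P.ContainsZero] [P.IsClosedUnderKernels]
  [P.IsClosedUnderCokernels] [P.IsClosedUnderFiniteProducts]

lemma shortExact_map_ι_iff (S : ShortComplex P.FullSubcategory) :
    (S.map P.ι).ShortExact ↔ S.ShortExact := by
  have := P.preservesKernels_ι
  have := P.preservesCokernels_ι
  have := P.ι.preservesFiniteLimits_of_preservesKernels
  have := P.ι.preservesFiniteColimits_of_preservesCokernels
  refine ⟨fun h => ?_, fun h => h.map_of_exact P.ι⟩
  exact
    { exact := (S.exact_map_iff_of_faithful P.ι).1 h.exact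
      mono_f := P.ι.mono_of_mono_map h.mono_f
      epi_g := P.ι.epi_of_epi_map h.epi_g }

lemma shortExactRelations_fullSubcategory :
    shortExactRelations P.FullSubcategory = relationsOn P := by
  rw [shortExactRelations, relationsOn]
  congr 1
  ext x
  constructor
  · rintro ⟨S, hS, rfl⟩
    exact ⟨S.map P.ι, S.X₁.property, S.X₂.property, S.X₃.property,
      (shortExact_map_ι_iff P S).2 hS, rfl⟩
  · rintro ⟨S, h₁, h₂, h₃, hS, rfl⟩
    let S' : ShortComplex P.FullSubcategory :=
      ShortComplex.mk (X₁ := ⟨S.X₁, h₁⟩) (X₂ := ⟨S.X₂, h₂⟩) (X₃ := ⟨S.X₃, h₃⟩)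
        (P.homMk S.f) (P.homMk S.g) (by ext; exact S.zero)
    exact ⟨S', (shortExact_map_ι_iff P S').1 hS, rfl⟩

/-- The two Grothendieck groups of a full subcategory `P` whose inclusion is exact agree: the
intrinsic one and the one defined by the ambient short exact sequences. -/
def k0EquivK0On : K0 P.FullSubcategory ≃+ K0On P :=
  QuotientAddGroup.quotientAddEquivOfEq (shortExactRelations_fullSubcategory P)

end FullSubcategory

lemma finite_endMulOpposite_hom (k : Type t) [CommRing k] [Linear k C] (X Y : C)
    [Module.Finite k (X ⟶ Y)] : Module.Finite (End X)ᵐᵒᵖ (X ⟶ Y) :=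
  have : IsScalarTower k (End X)ᵐᵒᵖ (X ⟶ Y) := ⟨fun a f g => Linear.smul_comp _ _ _ a f.unop g⟩
  .of_restrictScalars_finite k _ _

variable [HasExt.{w} C]

section CommonPerp

variable {n : ℕ}

/-- The common right perpendicular of a family of objects. -/
def commonPerp (T : Fin n → C) : ObjectProperty C :=
  fun X => ∀ i, rightPerp.{w} (T i) X

lemma commonPerp_fin_zero (T : Fin 0 → C) : commonPerp.{w} T = ⊤ :=
  top_unique fun _ _ => finZeroElim

lemma commonPerp_fin_succ (T : Fin (n + 1) → C) :
    commonPerp.{w} T = rightPerp.{w} (T 0) ⊓ commonPerp.{w} (Fin.tail T) := by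
  ext X
  exact Fin.forall_fin_succ

lemma commonPerp_eq_rightPerp (T : Fin n → C) : commonPerp.{w} T = rightPerp.{w} (⨁ T) := by
  ext X
  have h_ext (i : ℕ) : (∀ j, Subsingleton (Ext.{w} (T j) X i)) ↔
      Subsingleton (Ext.{w} (⨁ T) X i) := by
    rw [(Ext.biproductAddEquiv (biproduct.isBilimit T) X i).toEquiv.subsingleton_congr]
    exact ⟨fun _ => inferInstance, fun _ j =>
      (Function.surjective_eval (β := fun j => Ext.{w} (T j) X i) j).subsingleton⟩
  exact forall_comm.trans (forall_congr' h_ext)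

end CommonPerp

lemma IsExceptionalCollection.tail {n : ℕ} {T : Fin (n + 1) → C}
    (hT : IsExceptionalCollection.{w} T) : IsExceptionalCollection.{w} (Fin.tail T) where
  isExceptional i := hT.isExceptional i.succ
  ext_eq_zero i j hij m := hT.ext_eq_zero i.succ j.succ (Fin.succ_lt_succ_iff.2 hij) m

theorem nonempty_equiv_of_isExceptionalCollection {k : Type t} [CommRing k] [Linear k C] {n : ℕ}
    {T : Fin n → C} (hT : IsExceptionalCollection.{w} T) [∀ i, HasProjectiveDimensionLE (T i) 1]
    (hHom : ∀ i X, Module.Finite k (T i ⟶ X)) (hExt : ∀ i X, Module.Finite k (Ext.{w} (T i) X 1))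
    (P : ObjectProperty C) [IsWide P] (hPT : ∀ i, P (T i)) :
    Nonempty (K0On P ≃+ (Fin n → ℤ) × K0On (P ⊓ commonPerp.{w} T)) := by
  induction n generalizing P with
  | zero =>
    rw [commonPerp_fin_zero, inf_top_eq]
    exact ⟨AddEquiv.uniqueProd.symm⟩
  | succ n ih =>
    have (i : Fin n) : HasProjectiveDimensionLE (Fin.tail T i) 1 :=
      inferInstanceAs (HasProjectiveDimensionLE (T i.succ) 1)
    have (X : C) : Module.Finite (End (T 0))ᵐᵒᵖ (T 0 ⟶ X) := finite_endMulOpposite_hom k (T 0) X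
    have := hExt 0
    obtain ⟨e₁⟩ := nonempty_equiv_of_isExceptional (hPT 0) (hT.isExceptional 0) k
    obtain ⟨e₂⟩ := ih hT.tail (fun i => hHom i.succ) (fun i => hExt i.succ)
      (P ⊓ rightPerp.{w} (T 0)) fun i => ⟨hPT i.succ, hT.ext_eq_zero 0 i.succ (Fin.succ_pos i)⟩
    rw [inf_assoc, ← commonPerp_fin_succ] at e₂
    exact ⟨e₁.trans ((AddEquiv.prodCongr (.refl ℤ) e₂).trans
      (AddEquiv.prodAssoc.symm.trans
        (AddEquiv.prodCongr (Fin.consLinearEquiv ℤ fun _ => ℤ).toAddEquiv (.refl _))))⟩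

lemma IsExtFinite.finite_hom {k : Type t} [Field k] [Linear k C] (hC : IsExtFinite.{w} k C)
    (X Y : C) : Module.Finite k (X ⟶ Y) :=
  have := hC.finite_ext X Y 0
  .equiv (Ext.linearEquiv₀ (R := k) (X := X) (Y := Y))

end

end ExceptionalCollection

theorem mainTheorem8_general {k : Type t} [CommRing k]
    {B : Type u} [Category.{v} B] [Abelian B] [Linear k B] [HasExt.{w} B]
    {n : ℕ} (T : Fin n → B)
    (hT : IsExceptionalCollection.{w} T)
    [∀ i, HasProjectiveDimensionLE (T i) 1]
    (hHom : ∀ i X, Module.Finite k (T i ⟶ X))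
    (hExt : ∀ i X, Module.Finite k (Ext.{w} (T i) X 1)) :
    Nonempty (K0 B ≃+ (Fin n → ℤ) × K0 (rightPerp.{w} (⨁ T)).FullSubcategory) := by
  obtain ⟨e⟩ := nonempty_equiv_of_isExceptionalCollection hT hHom hExt ⊤ fun _ => trivial
  rw [top_inf_eq, commonPerp_eq_rightPerp] at e
  exact ⟨k0EquivTop.trans (e.trans (AddEquiv.prodCongr (.refl _) (k0EquivK0On _).symm))⟩

theorem mainTheorem8 {k : Type t} [Field k]
    {B : Type u} [Category.{v} B] [Abelian B] [Linear k B] [HasExt.{w} B]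
    (hB : IsExtFinite.{w} k B)
    {n : ℕ} (T : Fin n → B)
    (hT : IsExceptionalCollection.{w} T)
    [∀ i, HasProjectiveDimensionLE (T i) 1] :
    Nonempty (K0 B ≃+ (Fin n → ℤ) × K0 (rightPerp.{w} (⨁ T)).FullSubcategory) :=
  mainTheorem8_general T hT (fun i => hB.finite_hom (T i)) fun i X => hB.finite_ext (T i) X 1
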